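/- Let $F$ be a real birational map of the plane with a rational first integral $V=V_1/V_2$ ($V_1,V_2\in\mathbb R[x,y]$ coprime), that is, $V\circ F=V$ wherever both sides are defined. Let $\mathcal G\subset\mathbb R^2$ be a good set for $F$ and $V$: an open set on which $F$ and $V$ are defined and on which $F$ acts as a dynamical system, $F(\mathcal G)=\mathcal G$. Let $\mathcal H\subset\operatorname{Im}(V)$ be such that $\mathcal U:=\{V\in\mathcal H\}\cap\mathcal G$ is a nonempty open set and each curve $C_h:=\{V_1-hV_2=0\}$, $h\in\mathcal H$, is irreducible over $\mathbb C$ and has genus $0$. Let $X$ be a Lie symmetry of $F$ with first integral $V$, that is, a $C^1$ vector field on $\mathcal U$ such that, for all $p\in\mathcal U$, $X(F(p))=DF(p)\,X(p)$ and $DV(p)\,X(p)=0$, and $F(p)$ lies on the orbit of $p$ under the (local) flow $\varphi$ of $X$ in $\mathcal U$. Let $h\in\mathcal H$ and let $\gamma_h$ be a connected component of $C_h\cap\mathcal G$. Then: (a) If $\gamma_h$ is homeomorphic to the circle $\mathbb S^1$ and $X$ has no zeros on $\gamma_h$, then $\gamma_h$ is a periodic orbit of $X$, with some minimal period $T(h)>0$;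 there is $\tau(h)\in\mathbb R$ with $F(p)=\varphi(\tau(h),p)$ for all $p\in\gamma_h$; and, for every such $\tau(h)$, $F$ maps $\gamma_h$ into itself and $F|_{\gamma_h}$ is topologically conjugate to the rotation $\theta\mapsto\theta+\tau(h)/T(h)$ of $\mathbb R/\mathbb Z$, which has rotation number $\tau(h)/T(h)$. (b) If $\gamma_h$ is homeomorphic to $\mathbb R$ and $X$ has no zeros on $\gamma_h$, then $F$ maps $\gamma_h$ into itself and $F|_{\gamma_h}$ is topologically conjugate to a translation $s\mapsto s+a$ of $\mathbb R$. (c) If $\gamma_h$ is a point, then it is a fixed point of $F$. -/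

import Mathlib

open Set
open scoped KaehlerDifferential

noncomputable section

/-- The affine plane `ℝ²`. -/
abbrev RealPlane : Type := Fin 2 → ℝ

/-! ### Rational functions and birational maps of the plane -/

/-- A rational function on the real plane, written as a reduced fraction. -/
structure PlaneRatFun where
  num : MvPolynomial (Fin 2) ℝ
  den : MvPolynomial (Fin 2) ℝ
  den_ne_zero : den ≠ 0
  reduced : IsRelPrime num den

namespace PlaneRatFun

/-- The set of points where the rational function is defined. -/
def domain (f : PlaneRatFun) : Set RealPlane := {p | MvPolynomial.eval p f.den ≠ 0}

/-- The value of a rational function (meaningful on its domain). -/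
def eval (f : PlaneRatFun) (p : RealPlane) : ℝ :=
  MvPolynomial.eval p f.num / MvPolynomial.eval p f.den

/-- The set of values of a rational function. -/
def image (f : PlaneRatFun) : Set ℝ := f.eval '' f.domain

/-- The polynomial `V₁ - h V₂` of the curve `C_h` of the fibration of `V = V₁ / V₂`. -/
def fibrePoly (V : PlaneRatFun) (h : ℝ) : MvPolynomial (Fin 2) ℝ :=
  V.num - MvPolynomial.C h * V.den

/-- The real points of the curve `C_h = {V₁ - h V₂ = 0}`. -/
def fibre (V : PlaneRatFun) (h : ℝ) : Set RealPlane :=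
  {p | MvPolynomial.eval p (V.fibrePoly h) = 0}

end PlaneRatFun

/-- A rational map of the real plane, given by its two components. -/
structure PlaneRatMap where
  comp : Fin 2 → PlaneRatFun

namespace PlaneRatMap

/-- The set of points where the rational map is defined. -/
def domain (F : PlaneRatMap) : Set RealPlane := {p | ∀ i, p ∈ (F.comp i).domain}

/-- The value of a rational map (meaningful on its domain). -/
def eval (F : PlaneRatMap) (p : RealPlane) : RealPlane := fun i => (F.comp i).eval p

/-- `G ∘ F` is the identity as a rational map: it is defined somewhere (hence on a Zariski dense
open set), and is the identity wherever it is defined. -/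
def IsLeftInverseOf (G F : PlaneRatMap) : Prop :=
  (∃ p ∈ F.domain, F.eval p ∈ G.domain) ∧
    ∀ p ∈ F.domain, F.eval p ∈ G.domain → G.eval (F.eval p) = p

/-- A rational map is birational when it has a rational inverse. -/
def IsBirational (F : PlaneRatMap) : Prop :=
  ∃ G : PlaneRatMap, G.IsLeftInverseOf F ∧ F.IsLeftInverseOf G

/-- `V` is a first integral of `F`: `V ∘ F = V` wherever both sides are defined. -/
def HasFirstIntegral (F : PlaneRatMap) (V : PlaneRatFun) : Prop :=
  ∀ p ∈ F.domain, p ∈ V.domain → F.eval p ∈ V.domain → V.eval (F.eval p) = V.eval p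

/-- A good set for `F` and `V`: an open set on which `F` and `V` are defined, and on which `F`
acts as a dynamical system, `F(𝒢) = 𝒢`. -/
structure IsGoodSet (F : PlaneRatMap) (V : PlaneRatFun) (𝒢 : Set RealPlane) : Prop where
  isOpen : IsOpen 𝒢
  subset_domain : 𝒢 ⊆ F.domain
  subset_domain_integral : 𝒢 ⊆ V.domain
  image_eq : F.eval '' 𝒢 = 𝒢

end PlaneRatMap

/-! ### Geometric genus -/

/-- The regular (holomorphic) differentials of a function field `K` of one variable over `ℂ`:
the differentials `ω ∈ Ω[K⁄ℂ]` that are regular at every place, i.e. that for every valuation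
ring `ℂ ⊆ A ⊆ K` are sums of terms `a db` with `a, b ∈ A`. -/
def regularDifferentials (K : Type) [Field K] [Algebra ℂ K] : Submodule ℂ (Ω[K⁄ℂ]) :=
  ⨅ (A : ValuationSubring K) (_ : ∀ c : ℂ, algebraMap ℂ K c ∈ A),
    Submodule.span ℂ {ω | ∃ a ∈ A, ∃ b ∈ A, ω = a • KaehlerDifferential.D ℂ K b}

/-- The geometric genus of a function field of one variable over `ℂ`: the dimension of its space
of regular differentials. -/
def functionFieldGenus (K : Type) [Field K] [Algebra ℂ K] : Cardinal :=
  Module.rank ℂ (regularDifferentials K)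

/-- The plane curve `{f = 0}` in `ℂ²` is irreducible and has (geometric) genus `0`. The ideal of
the curve is the radical of `(f)`, and its function field is the residue field of that ideal. -/
def IsIrreducibleGenusZero (f : MvPolynomial (Fin 2) ℂ) : Prop :=
  f ≠ 0 ∧ ∃ _ : (Ideal.span {f}).radical.IsPrime,
    functionFieldGenus (Ideal.span {f}).radical.ResidueField = 0

/-- The set `𝒰 = {V ∈ ℋ} ∩ 𝒢`. -/
def fibredRegion (V : PlaneRatFun) (𝒢 : Set RealPlane) (ℋ : Set ℝ) : Set RealPlane :=
  {p | V.eval p ∈ ℋ} ∩ 𝒢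

/-- The curves `C_h`, `h ∈ ℋ`, form a genus `0` fibration of the nonempty open set
`{V ∈ ℋ} ∩ 𝒢`. -/
structure IsGenusZeroFibration (V : PlaneRatFun) (𝒢 : Set RealPlane) (ℋ : Set ℝ) : Prop where
  subset_image : ℋ ⊆ V.image
  isOpen : IsOpen (fibredRegion V 𝒢 ℋ)
  nonempty : (fibredRegion V 𝒢 ℋ).Nonempty
  genus_zero : ∀ h ∈ ℋ, IsIrreducibleGenusZero (MvPolynomial.map (algebraMap ℝ ℂ) (V.fibrePoly h))

/-! ### Flows and Lie symmetries -/

/-- `q = φ(t, p)`, where `φ` is the (local) flow in `U` of the vector field `X`: there is a solution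
of `ẋ = X(x)` in `U` that goes from `p` to `q` in time `t` (which may be negative). -/
def FlowsTo (X : RealPlane → RealPlane) (U : Set RealPlane) (t : ℝ) (p q : RealPlane) : Prop :=
  ∃ c : ℝ → RealPlane, c 0 = p ∧ c t = q ∧ MapsTo c (uIcc 0 t) U ∧
    IsIntegralCurveOn c (fun _ => X) (uIcc 0 t)

/-- The orbit of `p` under the flow of `X` in `U`. -/
def flowOrbit (X : RealPlane → RealPlane) (U : Set RealPlane) (p : RealPlane) : Set RealPlane :=
  {q | ∃ t : ℝ, FlowsTo X U t p q}

/-- `γ` is a periodic orbit of `X` in `U` with (minimal) period `T`. -/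
def IsPeriodicOrbit (X : RealPlane → RealPlane) (U γ : Set RealPlane) (T : ℝ) : Prop :=
  γ.Nonempty ∧
    ∀ p ∈ γ, flowOrbit X U p = γ ∧ IsLeast {t : ℝ | 0 < t ∧ FlowsTo X U t p p} T

/-- `X` is a Lie symmetry in `U` of the map `F`, with the same first integral `V` as `F`.
The last condition says, pointwise, that `F` moves points along the flow of `X`; that the time
this takes is constant on a curve is not part of the definition. -/
structure IsLieSymmetry (F : PlaneRatMap) (V : PlaneRatFun) (U : Set RealPlane)
    (X : RealPlane → RealPlane) : Prop where
  contDiffOn : ContDiffOn ℝ 1 X U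
  compatible : ∀ p ∈ U, X (F.eval p) = fderiv ℝ F.eval p (X p)
  first_integral : ∀ p ∈ U, fderiv ℝ V.eval p (X p) = 0
  mem_orbit : ∀ p ∈ U, F.eval p ∈ flowOrbit X U p

/-- `γ` is a connected component of the set `S`. -/
def IsConnectedComponentOf (γ S : Set RealPlane) : Prop :=
  ∃ p ∈ S, γ = connectedComponentIn S p

/-- `F` maps `γ` into itself, and `F|γ` is (topologically) conjugate to `g : Y → Y`. -/
def IsConjugateOn (F : RealPlane → RealPlane) (γ : Set RealPlane) {Y : Type} [TopologicalSpace Y]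
    (g : Y → Y) : Prop :=
  ∃ (hF : MapsTo F γ γ) (e : γ ≃ₜ Y), Function.Semiconj e (hF.restrict F γ γ) g

end

/-!
The map `F` acts on each component of a fibre as the time-`τ` map of the flow of the Lie symmetry
`X`, for one `τ`; the rest is the description of that flow.

The local flow of `X` in the open set `U = {V ∈ ℋ} ∩ 𝒢` is handled through the relation
`FlowsTo X U t p q`. Uniqueness of solutions makes it a partial action of `ℝ` (`FlowsTo.sub`,
`FlowsTo.trans`). Since `V` is constant along solutions, orbits stay in the connected components of
the fibres (`IsLieSymmetry.mem_connectedComponentIn`). In particular a component that is a single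
point `p` contains `F p`, which lies on the orbit of `p`.

Let now `γ` be a component that is a one-dimensional manifold without zeros of `X`. Solutions are
locally injective, so by invariance of domain in dimension one (`image_mem_nhds_of_injOn`) orbits
are open in `γ`, and `γ` is a single orbit (`IsInvariantCurve.flowOrbit_eq`). The relation
`X ∘ F = DF · X` says that `F` commutes with the flow (`IsLieSymmetry.flowsTo_eval`); if
`F p = φ(τ, p)` at one point of `γ`, then the same `τ` works at every point of `γ`
(`IsInvariantCurve.flowsTo_map`).

If `γ` is compact, a solution in it cannot be injective, since it would then be a homeomorphism
from a nonempty open subset of `ℝ` onto a compact space. Hence `γ` is a periodic orbit, its periods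
are the multiples of the least positive one `T`, and `θ ↦ φ(T θ, p)` is a homeomorphism from `ℝ / ℤ`
onto `γ` that conjugates `F` to the rotation by `τ / T`.

If `γ` is homeomorphic to `ℝ`, it is not compact, so solutions have no period and `t ↦ φ(t, p)` is a
homeomorphism from an open interval `I` onto `γ`. Here `F(𝒢) = 𝒢` is essential: it gives
`F(γ) = γ` (`IsLieSymmetry.surjOn`), so `I` is stable under both `t ↦ t + τ` and `t ↦ t - τ`. Thus
either `τ = 0` and `F` is the identity on `γ`, or `I = ℝ` and `F` is conjugate to the translation by
`τ`.
-/

open Filter Topology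

/-! ### The local flow of a vector field in an open set -/

section LocalFlow

variable {X : RealPlane → RealPlane} {U : Set RealPlane} {p q r : RealPlane} {s t : ℝ}

/-- An integral curve in `U`, defined on an interval, flows from each of its points to each other
one. -/
lemma IsIntegralCurveOn.flowsTo {c : ℝ → RealPlane} {S : Set ℝ} (hS : S.OrdConnected)
    (hc : IsIntegralCurveOn c (fun _ => X) S) (hU : MapsTo c S U) {a b : ℝ} (ha : a ∈ S)
    (hb : b ∈ S) : FlowsTo X U (b - a) (c a) (c b) := by
  have hsub : MapsTo (· + a) (uIcc 0 (b - a)) S := by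
    intro u hu
    refine hS.uIcc_subset ha hb ?_
    have h := mem_image_of_mem (· + a) hu
    simpa using h
  refine ⟨fun u => c (u + a), by simp, by simp, fun u hu => hU (hsub hu), fun u hu => ?_⟩
  have h1 := (hc _ (hsub hu)).scomp u
    (((hasDerivAt_id u).add_const a).hasDerivWithinAt (s := uIcc 0 (b - a))) hsub
  simpa using! h1

lemma FlowsTo.left_mem (h : FlowsTo X U t p q) : p ∈ U := by
  obtain ⟨c, rfl, -, hU, -⟩ := h
  exact hU left_mem_uIcc

lemma FlowsTo.right_mem (h : FlowsTo X U t p q) : q ∈ U := by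
  obtain ⟨c, -, rfl, hU, -⟩ := h
  exact hU right_mem_uIcc

/-- An orbit segment can be cut at any intermediate time. -/
lemma FlowsTo.exists_of_mem_uIcc (h : FlowsTo X U t p q) (hs : s ∈ uIcc 0 t) :
    ∃ r, FlowsTo X U s p r := by
  obtain ⟨c, rfl, -, hU, hc⟩ := h
  exact ⟨c s, by simpa using hc.flowsTo ordConnected_uIcc hU left_mem_uIcc hs⟩

lemma FlowsTo.refl (hp : p ∈ U) : FlowsTo X U 0 p p := by
  refine ⟨fun _ => p, rfl, rfl, fun _ _ => hp, fun t ht => ?_⟩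
  have : t = 0 := by simpa using ht
  subst this
  rw [uIcc_self]
  exact hasDerivWithinAt_iff_hasFDerivWithinAt.2 (.of_subsingleton subsingleton_singleton)

lemma FlowsTo.eq_of_zero (h : FlowsTo X U 0 p q) : p = q := by
  obtain ⟨c, rfl, rfl, -⟩ := h
  rfl

lemma FlowsTo.symm (h : FlowsTo X U t p q) : FlowsTo X U (-t) q p := by
  obtain ⟨c, rfl, rfl, hU, hc⟩ := h
  simpa using hc.flowsTo ordConnected_uIcc hU right_mem_uIcc left_mem_uIcc

/-- Uniqueness of solutions in `U`: the vector field is Lipschitz on the compact set swept out by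
the two curves. -/
lemma IsIntegralCurveOn.eqOn_uIcc (hU : IsOpen U) (hX : ContDiffOn ℝ 1 X U)
    {c d : ℝ → RealPlane} (hc : IsIntegralCurveOn c (fun _ => X) (uIcc 0 t))
    (hd : IsIntegralCurveOn d (fun _ => X) (uIcc 0 t)) (hcU : MapsTo c (uIcc 0 t) U)
    (hdU : MapsTo d (uIcc 0 t) U) (h0 : c 0 = d 0) : EqOn c d (uIcc 0 t) := by
  set K : Set RealPlane := c '' uIcc 0 t ∪ d '' uIcc 0 t with hK
  have hKU : K ⊆ U := union_subset hcU.image_subset hdU.image_subset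
  have hKc : IsCompact K :=
    (isCompact_uIcc.image_of_continuousOn hc.continuousOn).union
      (isCompact_uIcc.image_of_continuousOn hd.continuousOn)
  have hlip : LocallyLipschitzOn K X := by
    intro x hx
    obtain ⟨C, W, hW, hC⟩ :=
      (hX.contDiffAt (hU.mem_nhds (hKU hx))).exists_lipschitzOnWith
    exact ⟨C, W, mem_nhdsWithin_of_mem_nhds hW, hC⟩
  obtain ⟨C, hC⟩ := hlip.exists_lipschitzOnWith_of_compact hKc
  have hcK : ∀ u ∈ uIcc 0 t, c u ∈ K := fun u hu => Or.inl (mem_image_of_mem c hu)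
  have hdK : ∀ u ∈ uIcc 0 t, d u ∈ K := fun u hu => Or.inr (mem_image_of_mem d hu)
  rcases le_total 0 t with ht | ht
  · rw [uIcc_of_le ht] at *
    have key : ∀ {e : ℝ → RealPlane}, IsIntegralCurveOn e (fun _ => X) (Icc 0 t) →
        ∀ u ∈ Ico 0 t, HasDerivWithinAt e (X (e u)) (Ici u) u := fun he u hu =>
      (he u (Ico_subset_Icc_self hu)).mono_of_mem_nhdsWithin
        (mem_of_superset (Icc_mem_nhdsGE hu.2) (Icc_subset_Icc_left hu.1))
    exact ODE_solution_unique_of_mem_Icc_right (v := fun _ => X) (s := fun _ => K)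
      (fun _ _ => hC) hc.continuousOn (key hc) (fun u hu => hcK u (Ico_subset_Icc_self hu))
      hd.continuousOn (key hd) (fun u hu => hdK u (Ico_subset_Icc_self hu)) h0
  · rw [uIcc_of_ge ht] at *
    have key : ∀ {e : ℝ → RealPlane}, IsIntegralCurveOn e (fun _ => X) (Icc t 0) →
        ∀ u ∈ Ioc t 0, HasDerivWithinAt e (X (e u)) (Iic u) u := fun he u hu =>
      (he u (Ioc_subset_Icc_self hu)).mono_of_mem_nhdsWithin
        (mem_of_superset (Icc_mem_nhdsLE hu.1) (Icc_subset_Icc_right hu.2))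
    exact ODE_solution_unique_of_mem_Icc_left (v := fun _ => X) (s := fun _ => K)
      (fun _ _ => hC) hc.continuousOn (key hc) (fun u hu => hcK u (Ioc_subset_Icc_self hu))
      hd.continuousOn (key hd) (fun u hu => hdK u (Ioc_subset_Icc_self hu)) h0

lemma FlowsTo.unique (hU : IsOpen U) (hX : ContDiffOn ℝ 1 X U) (h : FlowsTo X U t p q)
    (h' : FlowsTo X U t p r) : q = r := by
  obtain ⟨c, hc0, rfl, hcU, hc⟩ := h
  obtain ⟨d, hd0, rfl, hdU, hd⟩ := h'
  exact hc.eqOn_uIcc hU hX hd hcU hdU (hc0.trans hd0.symm) right_mem_uIcc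

/-- Two integral curves through `q`, one in the past and one in the future, form one integral
curve. -/
lemma FlowsTo.of_nonpos_of_nonneg (h : FlowsTo X U s q p) (h' : FlowsTo X U t q r) (hs : s ≤ 0)
    (ht : 0 ≤ t) : FlowsTo X U (t - s) p r := by
  obtain ⟨c, hc0, rfl, hcU, hc⟩ := h
  obtain ⟨d, hd0, rfl, hdU, hd⟩ := h'
  rw [uIcc_of_ge hs] at hcU hc
  rw [uIcc_of_le ht] at hdU hd
  set e : ℝ → RealPlane := fun u => if u ≤ 0 then c u else d u with he
  have hec : EqOn e c (Icc s 0) := fun u hu => if_pos hu.2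
  have hed : EqOn e d (Icc 0 t) := fun u hu => by
    rcases hu.1.eq_or_lt with rfl | h
    · simp [he, hc0, hd0]
    · exact if_neg h.not_ge
  have hunion : Icc s t = Icc s 0 ∪ Icc 0 t := (Icc_union_Icc_eq_Icc hs ht).symm
  have heU : MapsTo e (Icc s t) U := by
    rw [hunion]
    exact (hcU.congr hec.symm).union (hdU.congr hed.symm)
  have hint : IsIntegralCurveOn e (fun _ => X) (Icc s t) := by
    -- A derivative within a closed interval, at a point off that interval, is arbitrary.
    have key : ∀ {f : ℝ → RealPlane} {a b : ℝ}, EqOn e f (Icc a b) →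
        IsIntegralCurveOn f (fun _ => X) (Icc a b) →
        ∀ u, HasDerivWithinAt e (X (e u)) (Icc a b) u := by
      intro f a b hef hf u
      by_cases hu : u ∈ Icc a b
      · have := (hf u hu).congr hef (hef hu)
        rwa [← hef hu] at this
      · exact hasDerivWithinAt_iff_hasFDerivWithinAt.2 (.of_notMem_closure (by rwa [closure_Icc]))
    intro u _
    rw [hunion]
    exact (key hec hc u).union (key hed hd u)
  have := hint.flowsTo ordConnected_Icc heU (left_mem_Icc.2 (hs.trans ht))
    (right_mem_Icc.2 (hs.trans ht))
  rwa [hec (left_mem_Icc.2 hs), hed (right_mem_Icc.2 ht)] at this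

lemma FlowsTo.of_mem_uIcc (hU : IsOpen U) (hX : ContDiffOn ℝ 1 X U) (h : FlowsTo X U s q p)
    (h' : FlowsTo X U t q r) (hs : s ∈ uIcc 0 t) : FlowsTo X U (t - s) p r := by
  obtain ⟨d, rfl, rfl, hdU, hd⟩ := h'
  have hsub := hd.flowsTo ordConnected_uIcc hdU left_mem_uIcc hs
  rw [sub_zero] at hsub
  obtain rfl := h.unique hU hX hsub
  exact hd.flowsTo ordConnected_uIcc hdU hs right_mem_uIcc

/-- The group law of the local flow, read at the intermediate point: the points reached from `q`
in times `s` and `t` are `t - s` apart. -/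
lemma FlowsTo.sub (hU : IsOpen U) (hX : ContDiffOn ℝ 1 X U) (h : FlowsTo X U s q p)
    (h' : FlowsTo X U t q r) : FlowsTo X U (t - s) p r := by
  rcases le_total s 0 with hs | hs <;> rcases le_total 0 t with ht | ht
  · exact h.of_nonpos_of_nonneg h' hs ht
  · rcases le_total s t with hst | hst
    · simpa using (h'.of_mem_uIcc hU hX h (mem_uIcc_of_ge hst ht)).symm
    · exact h.of_mem_uIcc hU hX h' (mem_uIcc_of_ge hst hs)
  · rcases le_total s t with hst | hst
    · exact h.of_mem_uIcc hU hX h' (mem_uIcc_of_le hs hst)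
    · simpa using (h'.of_mem_uIcc hU hX h (mem_uIcc_of_le ht hst)).symm
  · simpa using (h'.of_nonpos_of_nonneg h ht hs).symm

lemma FlowsTo.trans (hU : IsOpen U) (hX : ContDiffOn ℝ 1 X U) (h : FlowsTo X U s p q)
    (h' : FlowsTo X U t q r) : FlowsTo X U (s + t) p r := by
  simpa [add_comm] using h.symm.sub hU hX h'

lemma exists_integralCurve_Ioo (hU : IsOpen U) (hX : ContDiffOn ℝ 1 X U) (hp : p ∈ U) :
    ∃ c : ℝ → RealPlane, ∃ ε > 0, c 0 = p ∧ HasDerivAt c (X p) 0 ∧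
      ∀ t ∈ Ioo (-ε) ε, FlowsTo X U t p (c t) := by
  obtain ⟨c, hc0, ε, hε, hc⟩ := (hX.contDiffAt (hU.mem_nhds hp)
    ).exists_forall_mem_closedBall_exists_eq_forall_mem_Ioo_hasDerivAt₀ 0
  have hd := hc 0 (by simpa using hε)
  have hnear : ∀ᶠ t in 𝓝 (0 : ℝ), c t ∈ U :=
    hd.continuousAt.eventually_mem (by rw [hc0]; exact hU.mem_nhds hp)
  obtain ⟨δ, hδ, hcU⟩ := Metric.eventually_nhds_iff_ball.1 hnear
  rw [Real.ball_eq_Ioo, zero_sub, zero_add] at hcU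
  rw [zero_sub, zero_add] at hc
  refine ⟨c, min ε δ, lt_min hε hδ, hc0, hc0 ▸ hd, fun t ht => ?_⟩
  have hint : IsIntegralCurveOn c (fun _ => X) (Ioo (-(min ε δ)) (min ε δ)) := fun u hu =>
    (hc u ⟨by linarith [hu.1, min_le_left ε δ], by linarith [hu.2, min_le_left ε δ]⟩
      ).hasDerivWithinAt
  have := hint.flowsTo (U := U) ordConnected_Ioo (fun u hu => hcU u
    ⟨by linarith [hu.1, min_le_right ε δ], by linarith [hu.2, min_le_right ε δ]⟩)
    (a := 0) ⟨by linarith [lt_min hε hδ], lt_min hε hδ⟩ ht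
  rwa [sub_zero, hc0] at this

/-- The times at which the solution in `U` starting at `p` is defined. -/
def flowTimes (X : RealPlane → RealPlane) (U : Set RealPlane) (p : RealPlane) : Set ℝ :=
  {t | ∃ q, FlowsTo X U t p q}

open Classical in
/-- The maximal solution in `U` starting at `p`, extended by the constant `p` outside
`flowTimes X U p`. -/
noncomputable def flowCurve (X : RealPlane → RealPlane) (U : Set RealPlane) (p : RealPlane)
    (t : ℝ) : RealPlane :=
  if h : ∃ q, FlowsTo X U t p q then h.choose else p

lemma flowsTo_flowCurve (ht : t ∈ flowTimes X U p) : FlowsTo X U t p (flowCurve X U p t) := by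
  have h : ∃ q, FlowsTo X U t p q := ht
  rw [flowCurve, dif_pos h]
  exact h.choose_spec

lemma FlowsTo.flowCurve_eq (hU : IsOpen U) (hX : ContDiffOn ℝ 1 X U) (h : FlowsTo X U t p q) :
    flowCurve X U p t = q :=
  (flowsTo_flowCurve ⟨q, h⟩).unique hU hX h

/-- Near each of its times the maximal solution is a shift of a local one, so its domain is open
and it is continuous there. -/
lemma eventually_mem_flowTimes_and_continuousAt (hU : IsOpen U) (hX : ContDiffOn ℝ 1 X U)
    (ht : t ∈ flowTimes X U p) :
    (∀ᶠ s in 𝓝 t, s ∈ flowTimes X U p) ∧ ContinuousAt (flowCurve X U p) t := by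
  have h := flowsTo_flowCurve ht
  obtain ⟨c, ε, hε, hc0, hd, hc⟩ := exists_integralCurve_Ioo hU hX h.right_mem
  have hsh : ∀ᶠ s in 𝓝 t, FlowsTo X U s p (c (s - t)) := by
    filter_upwards [Ioo_mem_nhds (by linarith : t - ε < t) (by linarith : t < t + ε)] with s hs
    simpa using h.trans hU hX (hc (s - t) ⟨by linarith [hs.1], by linarith [hs.2]⟩)
  refine ⟨hsh.mono fun s hs => ⟨_, hs⟩, ?_⟩
  have hcont : ContinuousAt (fun s => c (s - t)) t :=
    ContinuousAt.comp (f := fun s => s - t) (g := c) (by simpa using hd.continuousAt) (by fun_prop)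
  exact hcont.congr (hsh.mono fun s hs => (hs.flowCurve_eq hU hX).symm)

lemma isOpen_flowTimes (hU : IsOpen U) (hX : ContDiffOn ℝ 1 X U) :
    IsOpen (flowTimes X U p) :=
  isOpen_iff_mem_nhds.2 fun _ ht => (eventually_mem_flowTimes_and_continuousAt hU hX ht).1

lemma continuousOn_flowCurve (hU : IsOpen U) (hX : ContDiffOn ℝ 1 X U) :
    ContinuousOn (flowCurve X U p) (flowTimes X U p) := fun _ ht =>
  (eventually_mem_flowTimes_and_continuousAt hU hX ht).2.continuousWithinAt

/-- The periods of the point `p` of `U`: the stabilizer of `p` under the local flow. -/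
def flowPeriods (hU : IsOpen U) (hX : ContDiffOn ℝ 1 X U) (hp : p ∈ U) : AddSubgroup ℝ where
  carrier := {t | FlowsTo X U t p p}
  add_mem' h h' := h.trans hU hX h'
  zero_mem' := FlowsTo.refl hp
  neg_mem' h := h.symm

lemma mem_flowPeriods {hU : IsOpen U} {hX : ContDiffOn ℝ 1 X U} {hp : p ∈ U} :
    t ∈ flowPeriods hU hX hp ↔ FlowsTo X U t p p := Iff.rfl

/-- Points on the same orbit have the same periods. -/
lemma FlowsTo.period_of_period (hU : IsOpen U) (hX : ContDiffOn ℝ 1 X U) (h : FlowsTo X U s p q)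
    (ht : FlowsTo X U t p p) : FlowsTo X U t q q := by
  simpa using h.symm.trans hU hX (ht.trans hU hX h)

/-- A zero-free vector field has no arbitrarily small periods at a given point. -/
lemma exists_pos_forall_period_eq_zero (hU : IsOpen U) (hX : ContDiffOn ℝ 1 X U) (hp : p ∈ U)
    (h0 : X p ≠ 0) : ∃ ε > 0, ∀ t, |t| < ε → FlowsTo X U t p p → t = 0 := by
  obtain ⟨c, ε, hε, hc0, hd, hc⟩ := exists_integralCurve_Ioo hU hX hp
  have hne : ∀ᶠ t in 𝓝[≠] (0 : ℝ), c t ≠ p := hd.eventually_ne h0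
  rw [eventually_nhdsWithin_iff] at hne
  obtain ⟨δ, hδ, hne⟩ := Metric.eventually_nhds_iff_ball.1 hne
  refine ⟨min ε δ, lt_min hε hδ, fun t ht h => ?_⟩
  by_contra ht0
  refine hne t (by simpa using ht.trans_le (min_le_right _ _)) ht0 ?_
  exact (hc t (abs_lt.1 (ht.trans_le (min_le_left _ _)))).unique hU hX h

/-- A periodic solution is defined at all times. -/
lemma flowTimes_eq_univ_of_period (hU : IsOpen U) (hX : ContDiffOn ℝ 1 X U) (ht0 : t ≠ 0)
    (h : FlowsTo X U t p p) : flowTimes X U p = univ := by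
  refine eq_univ_of_forall fun s => ?_
  obtain ⟨n, hn⟩ := exists_nat_gt (|s| / |t|)
  rw [div_lt_iff₀ (abs_pos.2 ht0)] at hn
  have hper : ∀ m : ℤ, FlowsTo X U (m • t) p p := fun m =>
    (flowPeriods hU hX h.left_mem).zsmul_mem h m
  have hpos : FlowsTo X U (n * |t|) p p := by
    rcases abs_choice t with h' | h'
    · simpa [h'] using hper n
    · simpa [h'] using hper (-n)
  rcases le_total 0 s with hs | hs
  · exact hpos.exists_of_mem_uIcc (mem_uIcc_of_le hs (by rw [abs_of_nonneg hs] at hn; exact hn.le))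
  · refine hpos.symm.exists_of_mem_uIcc (mem_uIcc_of_ge ?_ hs)
    rw [abs_of_nonpos hs] at hn
    linarith

end LocalFlow

/-! ### Injective curves in one-dimensional manifolds -/

/-- Invariance of domain in dimension one: an injective curve in a space that is locally
homeomorphic to `ℝ` covers a neighbourhood of each of its interior points. -/
lemma image_mem_nhds_of_injOn {Y : Type*} [TopologicalSpace Y] {π : ℝ → Y}
    (hπ : IsLocalHomeomorph π) (hsurj : Function.Surjective π) {f : ℝ → Y} {A : Set ℝ} {t : ℝ}
    (hA : A ∈ 𝓝 t) (hf : ContinuousOn f A) (hinj : InjOn f A) : f '' A ∈ 𝓝 (f t) := by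
  obtain ⟨x, hx⟩ := hsurj (f t)
  obtain ⟨e, hxe, rfl⟩ := hπ x
  have hft : f t ∈ e.target := hx ▸ e.map_source hxe
  have hev : ∀ᶠ s in 𝓝 t, s ∈ A ∧ f s ∈ e.target :=
    (show ∀ᶠ s in 𝓝 t, s ∈ A from hA).and
      ((hf.continuousAt hA).eventually_mem (e.open_target.mem_nhds hft))
  obtain ⟨ε, hε, hsub⟩ := (nhds_basis_Icc_pos t).eventually_iff.1 hev
  set g : ℝ → ℝ := fun s => e.symm (f s) with hg
  have hgc : ContinuousOn g (Icc (t - ε) (t + ε)) :=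
    e.continuousOn_symm.comp (hf.mono fun s hs => (hsub hs).1) fun s hs => (hsub hs).2
  have hgi : InjOn g (Icc (t - ε) (t + ε)) := fun s hs u hu hsu =>
    hinj (hsub hs).1 (hsub hu).1 (e.symm.injOn (hsub hs).2 (hsub hu).2 hsu)
  have hle : t - ε ≤ t + ε := by linarith
  have h1 : t - ε ∈ Icc (t - ε) (t + ε) := left_mem_Icc.2 hle
  have h2 : t ∈ Icc (t - ε) (t + ε) := ⟨by linarith, by linarith⟩
  have h3 : t + ε ∈ Icc (t - ε) (t + ε) := right_mem_Icc.2 hle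
  have hnhds : g '' Icc (t - ε) (t + ε) ∈ 𝓝 (g t) := by
    rcases hgc.strictMonoOn_of_injOn_Icc' hle hgi with hm | hm
    · exact mem_of_superset (Icc_mem_nhds (hm h1 h2 (by linarith)) (hm h2 h3 (by linarith)))
        (intermediate_value_Icc hle hgc)
    · exact mem_of_superset (Icc_mem_nhds (hm h2 h3 (by linarith)) (hm h1 h2 (by linarith)))
        (intermediate_value_Icc' hle hgc)
  have hev2 : ∀ᶠ y in 𝓝 (f t), y ∈ e.target ∧ e.symm y ∈ g '' Icc (t - ε) (t + ε) :=
    (e.open_target.eventually_mem hft).and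
      ((e.symm.continuousAt hft).eventually_mem hnhds)
  filter_upwards [hev2] with y hy
  obtain ⟨s, hs, hsy⟩ := hy.2
  exact ⟨s, (hsub hs).1, e.symm.injOn (hsub hs).2 hy.1 hsy⟩

/-! ### Invariant curves without zeros -/

/-- `γ` is a connected curve in `U`, locally homeomorphic to `ℝ`, that is invariant under the local
flow of the vector field `X` in `U` and contains no zero of `X`. The local structure is encoded by
a surjective local homeomorphism from `ℝ`. -/
structure IsInvariantCurve (X : RealPlane → RealPlane) (U γ : Set RealPlane) : Prop where
  subset : γ ⊆ U
  isConnected : IsConnected γ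
  orbit_subset : ∀ p ∈ γ, flowOrbit X U p ⊆ γ
  ne_zero : ∀ p ∈ γ, X p ≠ 0
  exists_isLocalHomeomorph : ∃ π : ℝ → γ, IsLocalHomeomorph π ∧ Function.Surjective π

section InvariantCurve

variable {X : RealPlane → RealPlane} {U γ : Set RealPlane} {p q : RealPlane} {s t : ℝ}

lemma IsInvariantCurve.flowCurve_mem (h : IsInvariantCurve X U γ) (hp : p ∈ γ) (t : ℝ) :
    flowCurve X U p t ∈ γ := by
  by_cases ht : t ∈ flowTimes X U p
  · exact h.orbit_subset p hp ⟨t, flowsTo_flowCurve ht⟩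
  · have : ¬ ∃ q, FlowsTo X U t p q := ht
    rwa [flowCurve, dif_neg this]

/-- The maximal solution starting at a point of an invariant curve, as a map into the curve. -/
noncomputable def IsInvariantCurve.param (h : IsInvariantCurve X U γ) (hp : p ∈ γ) (t : ℝ) : γ :=
  ⟨flowCurve X U p t, h.flowCurve_mem hp t⟩

lemma IsInvariantCurve.continuousOn_param (h : IsInvariantCurve X U γ) (hp : p ∈ γ)
    (hU : IsOpen U) (hX : ContDiffOn ℝ 1 X U) :
    ContinuousOn (h.param hp) (flowTimes X U p) :=
  continuousOn_iff_continuous_domRestrict.2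
    ((continuousOn_flowCurve hU hX).domRestrict.subtype_mk _)

/-- Two times at which the maximal solution takes the same value differ by a period. -/
lemma IsInvariantCurve.period_of_param_eq (h : IsInvariantCurve X U γ) (hp : p ∈ γ)
    (hU : IsOpen U) (hX : ContDiffOn ℝ 1 X U) (hs : s ∈ flowTimes X U p)
    (ht : t ∈ flowTimes X U p) (hst : h.param hp s = h.param hp t) : FlowsTo X U (s - t) p p := by
  have h1 := flowsTo_flowCurve hs
  rw [show flowCurve X U p s = flowCurve X U p t from congrArg Subtype.val hst] at h1
  simpa [sub_eq_add_neg] using h1.trans hU hX (flowsTo_flowCurve ht).symm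

lemma IsInvariantCurve.orbit_mem_nhds (h : IsInvariantCurve X U γ) (hU : IsOpen U)
    (hX : ContDiffOn ℝ 1 X U) (x : γ) : {y : γ | (y : RealPlane) ∈ flowOrbit X U x} ∈ 𝓝 x := by
  obtain ⟨p, hp⟩ := x
  obtain ⟨π, hπ, hsurj⟩ := h.exists_isLocalHomeomorph
  obtain ⟨ε, hε, hper⟩ := exists_pos_forall_period_eq_zero hU hX (h.subset hp) (h.ne_zero p hp)
  have hrefl := FlowsTo.refl (X := X) (h.subset hp)
  have h0 : (0 : ℝ) ∈ flowTimes X U p := ⟨p, hrefl⟩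
  -- Two times at distance less than `ε` cannot differ by a nonzero period.
  set A := flowTimes X U p ∩ Metric.ball 0 (ε / 2) with hA
  have hAn : A ∈ 𝓝 (0 : ℝ) :=
    inter_mem ((isOpen_flowTimes hU hX).mem_nhds h0) (Metric.ball_mem_nhds _ (by linarith))
  have hinj : InjOn (h.param hp) A := by
    intro s hs t ht hst
    have hs' : |s| < ε / 2 := by simpa using hs.2
    have ht' : |t| < ε / 2 := by simpa using ht.2
    refine sub_eq_zero.1 (hper _ ?_ (h.period_of_param_eq hp hU hX hs.1 ht.1 hst))
    exact (abs_sub s t).trans_lt (by linarith)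
  have key := image_mem_nhds_of_injOn hπ hsurj hAn
    ((h.continuousOn_param hp hU hX).mono inter_subset_left) hinj
  have hval : h.param hp 0 = ⟨p, hp⟩ := Subtype.ext (hrefl.flowCurve_eq hU hX)
  rw [hval] at key
  refine mem_of_superset key ?_
  rintro _ ⟨t, ht, rfl⟩
  exact ⟨t, flowsTo_flowCurve ht.1⟩

/-- The orbits in an invariant curve without zeros are open, so by connectedness there is only
one. -/
lemma IsInvariantCurve.flowOrbit_eq (h : IsInvariantCurve X U γ) (hU : IsOpen U)
    (hX : ContDiffOn ℝ 1 X U) (hp : p ∈ γ) : flowOrbit X U p = γ := by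
  refine (h.orbit_subset p hp).antisymm fun q hq => ?_
  have : PreconnectedSpace γ := isPreconnected_iff_preconnectedSpace.1 h.isConnected.isPreconnected
  set A : Set γ := {y : γ | (y : RealPlane) ∈ flowOrbit X U p} with hA
  have hclopen : IsClopen A := by
    constructor
    · refine ⟨isOpen_iff_mem_nhds.2 fun x hx => mem_of_superset (h.orbit_mem_nhds hU hX x) ?_⟩
      rintro y ⟨t, ht⟩ ⟨s, hs⟩
      exact hx ⟨_, hs.trans hU hX ht.symm⟩
    · refine isOpen_iff_mem_nhds.2 fun x hx => mem_of_superset (h.orbit_mem_nhds hU hX x) ?_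
      obtain ⟨s, hs⟩ := hx
      rintro y ⟨t, ht⟩
      exact ⟨_, hs.trans hU hX ht⟩
  have huniv := hclopen.eq_univ ⟨⟨p, hp⟩, 0, FlowsTo.refl (h.subset hp)⟩
  exact (huniv ▸ mem_univ (⟨q, hq⟩ : γ) : (⟨q, hq⟩ : γ) ∈ A)

/-- Without nonzero periods the maximal solution is a homeomorphism from its interval of
definition onto the curve. -/
lemma IsInvariantCurve.exists_homeomorph_of_periods (h : IsInvariantCurve X U γ) (hU : IsOpen U)
    (hX : ContDiffOn ℝ 1 X U) (hp : p ∈ γ) (hper : ∀ t, FlowsTo X U t p p → t = 0) :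
    ∃ e : flowTimes X U p ≃ₜ γ, ∀ t, e t = h.param hp t := by
  obtain ⟨π, hπ, hsurj⟩ := h.exists_isLocalHomeomorph
  have hopen : IsOpen (flowTimes X U p) := isOpen_flowTimes hU hX
  have hcont := h.continuousOn_param hp hU hX
  have hinj : InjOn (h.param hp) (flowTimes X U p) := fun s hs t ht hst =>
    sub_eq_zero.1 (hper _ (h.period_of_param_eq hp hU hX hs ht hst))
  have hbij : Function.Bijective ((flowTimes X U p).domRestrict (h.param hp)) := by
    refine ⟨injOn_iff_injective.1 hinj, fun y => ?_⟩
    obtain ⟨t, ht⟩ : (y : RealPlane) ∈ flowOrbit X U p := by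
      rw [h.flowOrbit_eq hU hX hp]
      exact y.2
    exact ⟨⟨t, _, ht⟩, Subtype.ext (ht.flowCurve_eq hU hX)⟩
  have hom : IsOpenMap ((flowTimes X U p).domRestrict (h.param hp)) := by
    intro B hB
    refine isOpen_iff_mem_nhds.2 ?_
    rintro _ ⟨t, ht, rfl⟩
    have hB' := image_mem_nhds_of_injOn hπ hsurj (A := Subtype.val '' B) (t := t)
      ((hopen.isOpenMap_subtype_val B hB).mem_nhds (mem_image_of_mem _ ht))
      (hcont.mono (by rintro _ ⟨u, -, rfl⟩; exact u.2))
      (hinj.mono (by rintro _ ⟨u, -, rfl⟩; exact u.2))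
    rw [image_image] at hB'
    exact hB'
  exact ⟨(Equiv.ofBijective _ hbij).toHomeomorphOfContinuousOpen hcont.domRestrict hom, fun t => rfl⟩

/-- A compact invariant curve without zeros is a periodic orbit: otherwise it would be homeomorphic
to a nonempty open subset of `ℝ`. -/
lemma IsInvariantCurve.exists_period_of_compact (h : IsInvariantCurve X U γ) (hU : IsOpen U)
    (hX : ContDiffOn ℝ 1 X U) (hp : p ∈ γ) (hc : CompactSpace γ) :
    ∃ t, t ≠ 0 ∧ FlowsTo X U t p p := by
  by_contra! hne
  obtain ⟨e, -⟩ := h.exists_homeomorph_of_periods hU hX hp fun t ht => by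
    by_contra h0
    exact hne t h0 ht
  have hcomp : IsCompact (flowTimes X U p) := isCompact_iff_compactSpace.2 e.symm.compactSpace
  have huniv := IsClopen.eq_univ ⟨hcomp.isClosed, isOpen_flowTimes hU hX⟩
    ⟨0, p, FlowsTo.refl (h.subset hp)⟩
  exact noncompact_univ ℝ (huniv ▸ hcomp)

/-- The periods along a periodic invariant curve without zeros have a common least positive
element. -/
lemma IsInvariantCurve.exists_isPeriodicOrbit (h : IsInvariantCurve X U γ) (hU : IsOpen U)
    (hX : ContDiffOn ℝ 1 X U) (hp : p ∈ γ) (ht0 : t ≠ 0) (ht : FlowsTo X U t p p) :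
    ∃ T, IsPeriodicOrbit X U γ T := by
  obtain ⟨ε, hε, hper⟩ := exists_pos_forall_period_eq_zero hU hX (h.subset hp) (h.ne_zero p hp)
  have hbot : flowPeriods hU hX (h.subset hp) ≠ ⊥ := fun hb => ht0 <| by
    have : t ∈ flowPeriods hU hX (h.subset hp) := ht
    rwa [hb, AddSubgroup.mem_bot] at this
  obtain ⟨T, hT⟩ := AddSubgroup.exists_isLeast_pos hbot hε <| disjoint_left.2 fun s hs hs' =>
    hs'.1.ne' (hper s (by rw [abs_of_pos hs'.1]; exact hs'.2) hs)
  refine ⟨T, ⟨p, hp⟩, fun q hq => ⟨h.flowOrbit_eq hU hX hq, ?_⟩⟩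
  obtain ⟨s, hs⟩ : q ∈ flowOrbit X U p := by rwa [h.flowOrbit_eq hU hX hp]
  refine ⟨⟨hT.1.2, hs.period_of_period hU hX hT.1.1⟩, fun u hu => hT.2 ⟨?_, hu.1⟩⟩
  exact hs.symm.period_of_period hU hX hu.2

/-- A noncompact invariant curve has no nonzero period, since a periodic orbit is the
compact image of one period. -/
lemma IsInvariantCurve.period_eq_zero_of_noncompact (h : IsInvariantCurve X U γ) (hU : IsOpen U)
    (hX : ContDiffOn ℝ 1 X U) (hp : p ∈ γ) (hc : ¬ CompactSpace γ) (ht : FlowsTo X U t p p) :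
    t = 0 := by
  by_contra ht0
  refine hc (isCompact_iff_compactSpace.1 ?_)
  have huniv := flowTimes_eq_univ_of_period hU hX ht0 ht
  have habs : FlowsTo X U |t| p p := by
    rcases abs_choice t with h' | h' <;> rw [h']
    exacts [ht, ht.symm]
  have himage : γ = flowCurve X U p '' Icc 0 |t| := by
    refine Subset.antisymm (fun q hq => ?_) ?_
    · obtain ⟨s, hs⟩ : q ∈ flowOrbit X U p := by rwa [h.flowOrbit_eq hU hX hp]
      have hpos : 0 < |t| := abs_pos.2 ht0
      refine ⟨toIcoMod hpos 0 s, ?_, ?_⟩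
      · have := toIcoMod_mem_Ico hpos 0 s
        exact ⟨this.1, by linarith [this.2]⟩
      · have hn : FlowsTo X U (-(toIcoDiv hpos 0 s • |t|)) p p :=
          (flowPeriods hU hX (h.subset hp)).neg_mem
            ((flowPeriods hU hX (h.subset hp)).zsmul_mem habs _)
        refine FlowsTo.flowCurve_eq hU hX ?_
        have := hn.trans hU hX hs
        rwa [neg_add_eq_sub] at this
    · rintro _ ⟨s, -, rfl⟩
      exact h.flowCurve_mem hp s
  rw [himage]
  refine isCompact_Icc.image_of_continuousOn ((continuousOn_flowCurve hU hX).mono ?_)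
  simp [huniv]

/-! ### Maps that commute with the flow -/

/-- A map that commutes with the flow and moves one point of an orbit by time `s` moves every point
of that orbit by time `s`. -/
lemma IsInvariantCurve.flowsTo_map (h : IsInvariantCurve X U γ) (hU : IsOpen U)
    (hX : ContDiffOn ℝ 1 X U) {Φ : RealPlane → RealPlane}
    (hΦ : ∀ t p q, FlowsTo X U t p q → FlowsTo X U t (Φ p) (Φ q)) (hp : p ∈ γ)
    (hs : FlowsTo X U s p (Φ p)) (hq : q ∈ γ) : FlowsTo X U s q (Φ q) := by
  obtain ⟨t, ht⟩ : q ∈ flowOrbit X U p := by rwa [h.flowOrbit_eq hU hX hp]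
  have := ht.symm.trans hU hX (hs.trans hU hX (hΦ t p q ht))
  rwa [add_comm, add_neg_cancel_right] at this

lemma IsInvariantCurve.mapsTo_of_flowsTo (h : IsInvariantCurve X U γ) {Φ : RealPlane → RealPlane}
    (hs : ∀ p ∈ γ, FlowsTo X U s p (Φ p)) : MapsTo Φ γ γ := fun p hp =>
  h.orbit_subset p hp ⟨s, hs p hp⟩

/-- On a periodic orbit of period `T`, the time-`s` map of the flow is conjugate to the rotation by
`s / T`. -/
lemma IsInvariantCurve.isConjugateOn_rotation (h : IsInvariantCurve X U γ) (hU : IsOpen U)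
    (hX : ContDiffOn ℝ 1 X U) {Φ : RealPlane → RealPlane} {T : ℝ}
    (hT : IsPeriodicOrbit X U γ T) (hs : ∀ p ∈ γ, FlowsTo X U s p (Φ p)) :
    IsConjugateOn Φ γ (fun θ : UnitAddCircle => θ + ((s / T : ℝ) : UnitAddCircle)) := by
  obtain ⟨⟨p, hp⟩, hT⟩ := hT
  obtain ⟨horb, hleast⟩ := hT p hp
  have hTpos : 0 < T := hleast.1.1
  have huniv : ∀ t, t ∈ flowTimes X U p := fun t => by
    rw [flowTimes_eq_univ_of_period hU hX hTpos.ne' hleast.1.2]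
    trivial
  have hper : ∀ t, FlowsTo X U t p p ↔ ∃ n : ℤ, t = n * T := by
    intro t
    have hcl : flowPeriods hU hX (h.subset hp) = AddSubgroup.closure {T} := by
      refine AddSubgroup.cyclic_of_min ⟨⟨hleast.1.2, hTpos⟩, fun u hu => hleast.2 ⟨hu.2, hu.1⟩⟩
    rw [← mem_flowPeriods (hU := hU) (hX := hX) (hp := h.subset hp), hcl,
      AddSubgroup.mem_closure_singleton]
    simp [eq_comm]
  have hcont : Continuous (h.param hp) :=
    continuousOn_univ.1 ((h.continuousOn_param hp hU hX).mono fun t _ => huniv t)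
  have hF : Function.Periodic (fun θ : ℝ => h.param hp (T * θ)) 1 := by
    intro θ
    refine Subtype.ext (FlowsTo.flowCurve_eq hU hX ?_)
    have := hleast.1.2.trans hU hX (flowsTo_flowCurve (huniv (T * θ)))
    have hθ : T * (θ + 1) = T + T * θ := by ring
    rwa [hθ]
  set E : UnitAddCircle → γ := hF.lift with hE
  have hEcoe : ∀ θ : ℝ, E (θ : UnitAddCircle) = h.param hp (T * θ) := fun θ => hF.lift_coe θ
  have hEcont : Continuous E := by
    refine continuous_quot_lift _ ?_
    exact hcont.comp (continuous_const.mul continuous_id)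
  have hbij : Function.Bijective E := by
    constructor
    · intro a b
      induction a using QuotientAddGroup.induction_on with | _ a => ?_
      induction b using QuotientAddGroup.induction_on with | _ b => ?_
      intro hab
      have hab' : h.param hp (T * a) = h.param hp (T * b) := hab
      obtain ⟨n, hn⟩ := (hper _).1 (h.period_of_param_eq hp hU hX (huniv _) (huniv _) hab')
      have hn' : a - b = n := mul_left_cancel₀ hTpos.ne' (by linarith)
      have : ((a - b : ℝ) : UnitAddCircle) = 0 := by
        rw [AddCircle.coe_eq_zero_iff]
        exact ⟨n, by simp [hn']⟩
      rwa [AddCircle.coe_sub, sub_eq_zero] at this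
    · intro y
      obtain ⟨t, ht⟩ : (y : RealPlane) ∈ flowOrbit X U p := by
        rw [horb]
        exact y.2
      refine ⟨((t / T : ℝ) : UnitAddCircle), Subtype.ext ?_⟩
      rw [hEcoe, mul_div_cancel₀ _ hTpos.ne']
      exact ht.flowCurve_eq hU hX
  have hmaps := h.mapsTo_of_flowsTo hs
  let e : UnitAddCircle ≃ₜ γ :=
    Continuous.homeoOfEquivCompactToT2 (f := Equiv.ofBijective E hbij) hEcont
  have he : ∀ a, e a = E a := fun _ => rfl
  refine ⟨hmaps, e.symm, fun y => ?_⟩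
  obtain ⟨a, rfl⟩ := e.surjective y
  rw [e.symm_apply_apply, e.symm_apply_eq, he, he]
  induction a using QuotientAddGroup.induction_on with | _ a => ?_
  refine Subtype.ext ?_
  have hsum : ((a : UnitAddCircle) + ((s / T : ℝ) : UnitAddCircle)) = ((a + s / T : ℝ)) := rfl
  change Φ (h.param hp (T * a)) = E ((a : UnitAddCircle) + ((s / T : ℝ) : UnitAddCircle))
  rw [hsum, hEcoe]
  have h1 := (flowsTo_flowCurve (huniv (T * a))).trans hU hX (hs _ (h.flowCurve_mem hp (T * a)))
  have h2 : T * (a + s / T) = T * a + s := by field_simp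
  rw [h2]
  exact (h1.flowCurve_eq hU hX).symm

/-- A bijective time-`s` map of the flow on an invariant line is conjugate to a translation. If
`s ≠ 0`, then the times at which a solution is defined are stable under `± s`, so the solutions are
defined on all of `ℝ`. -/
lemma IsInvariantCurve.isConjugateOn_translation (h : IsInvariantCurve X U γ) (hU : IsOpen U)
    (hX : ContDiffOn ℝ 1 X U) {Φ : RealPlane → RealPlane} (hline : Nonempty (γ ≃ₜ ℝ))
    (hs : ∀ p ∈ γ, FlowsTo X U s p (Φ p)) (hsurj : SurjOn Φ γ γ) :
    ∃ a : ℝ, IsConjugateOn Φ γ (fun u : ℝ => u + a) := by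
  obtain ⟨e₀⟩ := hline
  have hmaps := h.mapsTo_of_flowsTo hs
  rcases eq_or_ne s 0 with rfl | hs0
  · refine ⟨0, hmaps, e₀, fun y => ?_⟩
    refine Eq.trans ?_ (add_zero (e₀ y)).symm
    exact congrArg e₀ (Subtype.ext (hs y y.2).eq_of_zero.symm)
  obtain ⟨p, hp⟩ := h.isConnected.nonempty
  have hnc : ¬ CompactSpace γ := fun hc => not_compactSpace_iff.2 inferInstance e₀.compactSpace
  obtain ⟨e, he⟩ := h.exists_homeomorph_of_periods hU hX hp fun t ht =>
    h.period_eq_zero_of_noncompact hU hX hp hnc ht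
  have hfwd : ∀ q ∈ γ, ∃ r ∈ γ, FlowsTo X U s q r := fun q hq => ⟨Φ q, hmaps hq, hs q hq⟩
  have hbwd : ∀ q ∈ γ, ∃ r ∈ γ, FlowsTo X U (-s) q r := fun q hq => by
    obtain ⟨r, hr, rfl⟩ := hsurj hq
    exact ⟨r, hr, (hs r hr).symm⟩
  have habs : ∀ n : ℕ, (∃ r ∈ γ, FlowsTo X U (n * s) p r) ∧
      ∃ r ∈ γ, FlowsTo X U (n * -s) p r := by
    intro n
    induction n with
    | zero =>
      have := FlowsTo.refl (X := X) (h.subset hp)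
      exact ⟨⟨p, hp, by simpa using this⟩, ⟨p, hp, by simpa using this⟩⟩
    | succ n ih =>
      obtain ⟨⟨r, hr, h1⟩, ⟨r', hr', h2⟩⟩ := ih
      obtain ⟨q, hq, h3⟩ := hfwd r hr
      obtain ⟨q', hq', h4⟩ := hbwd r' hr'
      refine ⟨⟨q, hq, ?_⟩, ⟨q', hq', ?_⟩⟩
      · have := h1.trans hU hX h3
        rwa [Nat.cast_succ, add_one_mul]
      · have := h2.trans hU hX h4
        rwa [Nat.cast_succ, add_one_mul]
  have huniv : flowTimes X U p = univ := by
    refine eq_univ_of_forall fun t => ?_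
    obtain ⟨n, hn⟩ := exists_nat_gt (|t| / |s|)
    rw [div_lt_iff₀ (abs_pos.2 hs0)] at hn
    obtain ⟨h1, h2⟩ := abs_lt.1 hn
    have hpos : (∃ r, FlowsTo X U (n * |s|) p r) ∧ ∃ r, FlowsTo X U (-(n * |s|)) p r := by
      obtain ⟨⟨r, -, hr⟩, ⟨r', -, hr'⟩⟩ := habs n
      rcases abs_choice s with h' | h' <;> rw [h']
      · exact ⟨⟨r, hr⟩, ⟨r', by simpa using hr'⟩⟩
      · exact ⟨⟨r', hr'⟩, ⟨r, by simpa using hr⟩⟩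
    obtain ⟨⟨r, hr⟩, ⟨r', hr'⟩⟩ := hpos
    rcases le_total 0 t with ht | ht
    · exact hr.exists_of_mem_uIcc (mem_uIcc_of_le ht h2.le)
    · exact hr'.exists_of_mem_uIcc (mem_uIcc_of_ge h1.le ht)
  let e' : ℝ ≃ₜ γ := ((Homeomorph.Set.univ ℝ).symm.trans (Homeomorph.setCongr huniv.symm)).trans e
  have he' : ∀ t, e' t = h.param hp t := fun t => he _
  refine ⟨s, hmaps, e'.symm, fun y => ?_⟩
  obtain ⟨t, rfl⟩ := e'.surjective y
  rw [e'.symm_apply_apply, e'.symm_apply_eq]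
  refine Subtype.ext ?_
  have ht : t ∈ flowTimes X U p := huniv ▸ mem_univ t
  have h1 := (flowsTo_flowCurve ht).trans hU hX (hs _ (h.flowCurve_mem hp t))
  change Φ (e' t) = (e' (t + s) : RealPlane)
  rw [he', he']
  exact (h1.flowCurve_eq hU hX).symm

end InvariantCurve

/-! ### Rational maps with a first integral and their Lie symmetries -/

lemma PlaneRatFun.differentiableAt {f : PlaneRatFun} {p : RealPlane} (hp : p ∈ f.domain) :
    DifferentiableAt ℝ f.eval p := by
  have h (g : MvPolynomial (Fin 2) ℝ) :
      DifferentiableAt ℝ (fun x : RealPlane => MvPolynomial.eval x g) p :=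
    (AnalyticOnNhd.eval_mvPolynomial g p (mem_univ p)).differentiableAt
  have heval : f.eval = fun x => MvPolynomial.eval x f.num * (MvPolynomial.eval x f.den)⁻¹ :=
    funext fun _ => div_eq_mul_inv _ _
  rw [heval]
  exact (h f.num).mul ((h f.den).inv hp)

lemma PlaneRatMap.differentiableAt {F : PlaneRatMap} {p : RealPlane} (hp : p ∈ F.domain) :
    DifferentiableAt ℝ F.eval p :=
  differentiableAt_pi.2 fun i => PlaneRatFun.differentiableAt (hp i)

lemma PlaneRatFun.mem_fibre_iff {V : PlaneRatFun} {h : ℝ} {p : RealPlane} (hp : p ∈ V.domain) :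
    p ∈ V.fibre h ↔ V.eval p = h := by
  have hp' : MvPolynomial.eval p V.den ≠ 0 := hp
  simp [PlaneRatFun.fibre, PlaneRatFun.fibrePoly, PlaneRatFun.eval, div_eq_iff hp', sub_eq_zero]

section LieSymmetry

variable {F : PlaneRatMap} {V : PlaneRatFun} {𝒢 : Set RealPlane} {ℋ : Set ℝ}
  {X : RealPlane → RealPlane} {p q : RealPlane} {t h : ℝ}

lemma PlaneRatMap.IsGoodSet.fibre_inter_subset_fibredRegion (h𝒢 : F.IsGoodSet V 𝒢) (hh : h ∈ ℋ) :
    V.fibre h ∩ 𝒢 ⊆ fibredRegion V 𝒢 ℋ := fun p hp => by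
  refine ⟨?_, hp.2⟩
  change V.eval p ∈ ℋ
  rwa [(PlaneRatFun.mem_fibre_iff (h𝒢.subset_domain_integral hp.2)).1 hp.1]

/-- A first integral of the vector field is constant along solutions, and solutions are connected,
so the flow preserves the connected components of the fibres. -/
lemma IsLieSymmetry.mem_connectedComponentIn (hX : IsLieSymmetry F V (fibredRegion V 𝒢 ℋ) X)
    (h𝒢 : F.IsGoodSet V 𝒢) (hp : p ∈ V.fibre h)
    (hpq : FlowsTo X (fibredRegion V 𝒢 ℋ) t p q) : q ∈ connectedComponentIn (V.fibre h ∩ 𝒢) p := by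
  obtain ⟨c, rfl, rfl, hcU, hc⟩ := hpq
  have hVc : ∀ u ∈ uIcc 0 t, HasDerivWithinAt (V.eval ∘ c) 0 (uIcc 0 t) u := fun u hu => by
    have hd := PlaneRatFun.differentiableAt (h𝒢.subset_domain_integral (hcU hu).2)
    have := hd.hasFDerivAt.comp_hasDerivWithinAt u (hc u hu)
    rwa [hX.first_integral _ (hcU hu)] at this
  have hconst : ∀ u ∈ uIcc 0 t, V.eval (c u) = V.eval (c 0) := fun u hu => by
    have := (convex_uIcc 0 t).norm_image_sub_le_of_norm_hasDerivWithin_le (C := 0) hVc (by simp)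
      left_mem_uIcc hu
    simpa [sub_eq_zero] using this
  have hV0 : V.eval (c 0) = h :=
    (PlaneRatFun.mem_fibre_iff (h𝒢.subset_domain_integral (hcU left_mem_uIcc).2)).1 hp
  have hsub : c '' uIcc 0 t ⊆ V.fibre h ∩ 𝒢 := by
    rintro _ ⟨u, hu, rfl⟩
    refine ⟨(PlaneRatFun.mem_fibre_iff (h𝒢.subset_domain_integral (hcU hu).2)).2 ?_, (hcU hu).2⟩
    rw [hconst u hu, hV0]
  exact (isPreconnected_uIcc.image c hc.continuousOn).subset_connectedComponentIn
    (mem_image_of_mem c left_mem_uIcc) hsub (mem_image_of_mem c right_mem_uIcc)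

/-- The relation `X ∘ F = DF · X` makes `F` carry solutions of `X` to solutions. -/
lemma IsLieSymmetry.flowsTo_eval (hX : IsLieSymmetry F V (fibredRegion V 𝒢 ℋ) X)
    (h𝒢 : F.IsGoodSet V 𝒢) (hpq : FlowsTo X (fibredRegion V 𝒢 ℋ) t p q) :
    FlowsTo X (fibredRegion V 𝒢 ℋ) t (F.eval p) (F.eval q) := by
  obtain ⟨c, rfl, rfl, hcU, hc⟩ := hpq
  refine ⟨F.eval ∘ c, rfl, rfl, fun u hu => ?_, fun u hu => ?_⟩
  · obtain ⟨s, hs⟩ := hX.mem_orbit _ (hcU hu)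
    exact hs.right_mem
  · have hd := PlaneRatMap.differentiableAt (h𝒢.subset_domain (hcU hu).2)
    have := hd.hasFDerivAt.comp_hasDerivWithinAt u (hc u hu)
    rwa [← hX.compatible _ (hcU hu)] at this

/-- A connected component of a fibre that is a one-dimensional manifold without zeros of the Lie
symmetry is an invariant curve of it. -/
lemma IsLieSymmetry.isInvariantCurve (hX : IsLieSymmetry F V (fibredRegion V 𝒢 ℋ) X)
    (h𝒢 : F.IsGoodSet V 𝒢) (hh : h ∈ ℋ) {γ : Set RealPlane}
    (hγ : IsConnectedComponentOf γ (V.fibre h ∩ 𝒢)) (h0 : ∀ p ∈ γ, X p ≠ 0)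
    (hπ : ∃ π : ℝ → γ, IsLocalHomeomorph π ∧ Function.Surjective π) :
    IsInvariantCurve X (fibredRegion V 𝒢 ℋ) γ := by
  obtain ⟨p, hp, rfl⟩ := hγ
  refine ⟨?_, isConnected_connectedComponentIn_iff.2 hp, ?_, h0, hπ⟩
  · exact (connectedComponentIn_subset _ _).trans (h𝒢.fibre_inter_subset_fibredRegion hh)
  · rintro q hq r ⟨t, ht⟩
    rw [connectedComponentIn_eq hq]
    exact hX.mem_connectedComponentIn h𝒢 (connectedComponentIn_subset _ _ hq).1 ht

/-- As `F(𝒢) = 𝒢` and `F` preserves the fibres, `F` maps each component of a fibre that is an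
invariant curve of the Lie symmetry onto itself. -/
lemma IsLieSymmetry.surjOn (hX : IsLieSymmetry F V (fibredRegion V 𝒢 ℋ) X)
    (hV : F.HasFirstIntegral V) (h𝒢 : F.IsGoodSet V 𝒢) (hh : h ∈ ℋ) {γ : Set RealPlane}
    (hγ : IsConnectedComponentOf γ (V.fibre h ∩ 𝒢))
    (hinv : IsInvariantCurve X (fibredRegion V 𝒢 ℋ) γ) : SurjOn F.eval γ γ := by
  obtain ⟨p, hp, rfl⟩ := hγ
  intro q hq
  have hqS := connectedComponentIn_subset _ _ hq
  obtain ⟨r, hr, rfl⟩ : q ∈ F.eval '' 𝒢 := by rw [h𝒢.image_eq]; exact hqS.2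
  have hrV := h𝒢.subset_domain_integral hr
  have hqV := h𝒢.subset_domain_integral hqS.2
  have hrfib : r ∈ V.fibre h := by
    rw [PlaneRatFun.mem_fibre_iff hrV, ← hV r (h𝒢.subset_domain hr) hrV hqV]
    exact (PlaneRatFun.mem_fibre_iff hqV).1 hqS.1
  obtain ⟨t, ht⟩ := hX.mem_orbit r (h𝒢.fibre_inter_subset_fibredRegion hh ⟨hrfib, hr⟩)
  exact ⟨r, hinv.orbit_subset _ hq ⟨-t, ht.symm⟩, rfl⟩

end LieSymmetry

lemma exists_isLocalHomeomorph_of_homeomorph_circle {Y : Type*} [TopologicalSpace Y]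
    (e : Y ≃ₜ Circle) : ∃ π : ℝ → Y, IsLocalHomeomorph π ∧ Function.Surjective π := by
  let e' : AddCircle (2 * Real.pi) ≃ₜ Y := AddCircle.homeomorphCircle'.trans e.symm
  exact ⟨_, e'.isLocalHomeomorph.comp (AddCircle.isLocalHomeomorph_coe (2 * Real.pi)),
    e'.surjective.comp (QuotientAddGroup.mk_surjective)⟩

theorem mainTheorem3 (F : PlaneRatMap) (V : PlaneRatFun) (𝒢 : Set RealPlane) (ℋ : Set ℝ)
    (X : RealPlane → RealPlane)
    (hF : F.IsBirational) (hV : F.HasFirstIntegral V) (h𝒢 : F.IsGoodSet V 𝒢)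
    (hℋ : IsGenusZeroFibration V 𝒢 ℋ) (hX : IsLieSymmetry F V (fibredRegion V 𝒢 ℋ) X)
    (h : ℝ) (hh : h ∈ ℋ) (γ : Set RealPlane)
    (hγ : IsConnectedComponentOf γ (V.fibre h ∩ 𝒢)) :
    (Nonempty (γ ≃ₜ Circle) → (∀ p ∈ γ, X p ≠ 0) →
      (∃ T, IsPeriodicOrbit X (fibredRegion V 𝒢 ℋ) γ T) ∧
      (∃ τ, ∀ p ∈ γ, FlowsTo X (fibredRegion V 𝒢 ℋ) τ p (F.eval p)) ∧
      ∀ T τ : ℝ, IsPeriodicOrbit X (fibredRegion V 𝒢 ℋ) γ T →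
        (∀ p ∈ γ, FlowsTo X (fibredRegion V 𝒢 ℋ) τ p (F.eval p)) →
        IsConjugateOn F.eval γ (fun θ : UnitAddCircle => θ + ((τ / T : ℝ) : UnitAddCircle))) ∧
    (Nonempty (γ ≃ₜ ℝ) → (∀ p ∈ γ, X p ≠ 0) →
      ∃ a : ℝ, IsConjugateOn F.eval γ (fun s : ℝ => s + a)) ∧
    (∀ p, γ = {p} → F.eval p = p) := by
  have hU := hℋ.isOpen
  have htime : IsInvariantCurve X (fibredRegion V 𝒢 ℋ) γ →
      ∃ τ, ∀ p ∈ γ, FlowsTo X (fibredRegion V 𝒢 ℋ) τ p (F.eval p) := fun hinv => by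
    obtain ⟨p, hp⟩ := hinv.isConnected.nonempty
    obtain ⟨τ, hτ⟩ := hX.mem_orbit p (hinv.subset hp)
    exact ⟨τ, fun q hq => hinv.flowsTo_map hU hX.contDiffOn
      (fun _ _ _ => hX.flowsTo_eval h𝒢) hp hτ hq⟩
  refine ⟨fun ⟨e⟩ h0 => ?_, fun ⟨e⟩ h0 => ?_, ?_⟩
  · have hinv := hX.isInvariantCurve h𝒢 hh hγ h0 (exists_isLocalHomeomorph_of_homeomorph_circle e)
    refine ⟨?_, htime hinv, fun T τ hT hτ => hinv.isConjugateOn_rotation hU hX.contDiffOn hT hτ⟩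
    obtain ⟨p, hp⟩ := hinv.isConnected.nonempty
    obtain ⟨t, ht0, ht⟩ :=
      hinv.exists_period_of_compact hU hX.contDiffOn hp e.symm.compactSpace
    exact hinv.exists_isPeriodicOrbit hU hX.contDiffOn hp ht0 ht
  · have hinv := hX.isInvariantCurve h𝒢 hh hγ h0
      ⟨e.symm, e.symm.isLocalHomeomorph, e.symm.surjective⟩
    obtain ⟨τ, hτ⟩ := htime hinv
    exact hinv.isConjugateOn_translation hU hX.contDiffOn ⟨e⟩ hτ (hX.surjOn hV h𝒢 hh hγ hinv)
  · rintro p rfl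
    obtain ⟨q, hq, hpq⟩ := hγ
    obtain rfl : q = p := by
      have := mem_connectedComponentIn hq
      rwa [← hpq, mem_singleton_iff] at this
    obtain ⟨t, ht⟩ := hX.mem_orbit q (h𝒢.fibre_inter_subset_fibredRegion hh hq)
    have := hX.mem_connectedComponentIn h𝒢 hq.1 ht
    rwa [← hpq, mem_singleton_iff] at this
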